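/- Let $L$ be an SPS lattice, that is, a finite lattice that is semimodular, slim (it has no sublattice isomorphic to $M_3$) and planar (it has a planar Hasse diagram); fix a planar diagram of $L$. Let $S=\{o,a_l,a_r,t\}$ be a covering square of $L$ ($o=a_l\wedge a_r$, $t=a_l\vee a_r$, $o\prec a_l\prec t$, $o\prec a_r\prec t$) with $a_l$ to the left of $a_r$. Let $L[S]$ be the fork extension of $L$ at $S$. It is obtained from $L$ as follows. Insert new elements $b_l,b_r,m$ with $o\prec b_l\prec a_l$, $o\prec b_r\prec a_r$, $b_l\prec m$, $b_r\prec m$, $m\prec t$. Then, as long as there is a chain $u\prec v\prec w$ with $u,w\in L$ and $v$ just inserted, and an element $z\in L$ such that $\{u\wedge z,z,u,w=z\vee u\}$ is a covering square of $L$ and no new element has yet been inserted between $x=u\wedge z$ and $z$, insert a new element $y$ with $x\prec y\prec z$ and $y\prec v$. For a lattice $K$ and $a,b\in K$ let $\operatorname{con}_K(a,b)$ be the smallest congruence of $K$ that collapses $a$ and $b$, and put $\gamma(S)=\operatorname{con}_{L[S]}(m,t)$. The congruence of $L[S]$ generated by a congruence $\alpha$ of $L$ is the smallest congruence of $L[S]$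 containing $\alpha$. Suppose that $S$ is wide, that is, $t$ covers in $L$ an element other than $a_l$ and $a_r$. Then $L[S]$ is a lattice, the congruences $\operatorname{con}_L(a_l,t)$ and $\operatorname{con}_L(a_r,t)$ of $L$ are join-irreducible, and $\gamma(S)$ is generated by one of them. More precisely, if $t$ covers an element to the right of $a_r$, then $\gamma(S)$ is the congruence of $L[S]$ generated by $\operatorname{con}_L(a_r,t)$; symmetrically, if $t$ covers an element to the left of $a_l$, then $\gamma(S)$ is the congruence of $L[S]$ generated by $\operatorname{con}_L(a_l,t)$; and at least one of these two equalities holds. -/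

import Mathlib

/-! ### Congruences of a lattice -/

namespace LatticeCon

variable {α : Type*} [Lattice α]

/-- Congruences are determined by their underlying relation. -/
theorem toSetoid_inj : Function.Injective (LatticeCon.toSetoid (α := α)) := by
  rintro ⟨s, h1, h2⟩ ⟨s', h1', h2'⟩ h
  cases h
  rfl

/-- Congruences are ordered by inclusion. -/
instance instPartialOrder : PartialOrder (LatticeCon α) :=
  PartialOrder.lift LatticeCon.toSetoid toSetoid_inj

/-- The intersection of a set of congruences. -/
instance instInfSet : InfSet (LatticeCon α) where
  sInf C :=
    { r := fun x y => ∀ θ ∈ C, θ.r x y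
      iseqv :=
        { refl := fun x θ _ => θ.iseqv.refl x
          symm := fun h θ hθ => θ.iseqv.symm (h θ hθ)
          trans := fun h h' θ hθ => θ.iseqv.trans (h θ hθ) (h' θ hθ) }
      inf := fun h h' θ hθ => θ.inf (h θ hθ) (h' θ hθ)
      sup := fun h h' θ hθ => θ.sup (h θ hθ) (h' θ hθ) }

/-- The congruence lattice `Con α`. -/
instance instCompleteLattice : CompleteLattice (LatticeCon α) :=
  completeLatticeOfInf (LatticeCon α) fun _ =>
    ⟨fun θ hθ _ _ h => h θ hθ, fun _ hφ _ _ h _ hθ => hφ hθ h⟩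

/-- `con a b`: the smallest congruence collapsing `a` and `b`. -/
def con (a b : α) : LatticeCon α := sInf {θ | θ.r a b}

/-- For a map `f : α → β` (an inclusion), the congruence of `β` generated by the congruence `θ`
of `α`: the smallest congruence of `β` that contains the image of `θ`. -/
def generated {β : Type*} [Lattice β] (f : α → β) (θ : LatticeCon α) : LatticeCon β :=
  sInf {φ | ∀ x y, θ.r x y → φ.r (f x) (f y)}

end LatticeCon

/-! ### Slim, planar, semimodular lattices

Semimodularity is Mathlib's `IsUpperModularLattice`. -/

/-- A lattice is slim if it has no sublattice isomorphic to `M₃`, that is, if there are no three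
distinct elements with equal pairwise meets and equal pairwise joins. -/
def IsSlim (L : Type*) [Lattice L] : Prop :=
  ¬ ∃ a b c : L, a ≠ b ∧ a ≠ c ∧ b ≠ c ∧
    a ⊓ b = a ⊓ c ∧ a ⊓ b = b ⊓ c ∧ a ⊔ b = a ⊔ c ∧ a ⊔ b = b ⊔ c

/-- A planar (Hasse) diagram of an ordered set: the elements are distinct points of the plane,
larger elements are higher, every covering pair is joined by a straight line segment, and two
different edges meet in common endpoints only. -/
structure PlanarDiagram (L : Type*) [PartialOrder L] where
  /-- The point of the plane that represents an element. -/
  pos : L → ℝ × ℝ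
  pos_injective : Function.Injective pos
  height_strictMono : ∀ a b : L, a < b → (pos a).2 < (pos b).2
  edges_noncrossing : ∀ a b c d : L, a ⋖ b → c ⋖ d → (a, b) ≠ (c, d) →
    segment ℝ (pos a) (pos b) ∩ segment ℝ (pos c) (pos d) ⊆
      {pos a, pos b} ∩ {pos c, pos d}

/-- For lower covers `a`, `b` of `t`: `a` is to the left of `b` in the diagram, that is, of the two
edges going down from `t`, the edge to `a` leaves `t` to the left of the edge to `b`
(the horizontal displacements per unit of descent are compared). -/
def PlanarDiagram.LeftOf {L : Type*} [PartialOrder L] (D : PlanarDiagram L) (t a b : L) : Prop :=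
  a ⋖ t ∧ b ⋖ t ∧
    ((D.pos a).1 - (D.pos t).1) / ((D.pos t).2 - (D.pos a).2) <
      ((D.pos b).1 - (D.pos t).1) / ((D.pos t).2 - (D.pos b).2)

/-! ### Covering squares -/

/-- `{o, a, b, t}` is a covering square with bottom `o`, top `t` and sides `a`, `b`. -/
structure IsCoveringSquare {L : Type*} [Lattice L] (o a b t : L) : Prop where
  inf_eq : a ⊓ b = o
  sup_eq : a ⊔ b = t
  bot_covBy_left : o ⋖ a
  bot_covBy_right : o ⋖ b
  left_covBy_top : a ⋖ t
  right_covBy_top : b ⋖ t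

/-- A covering square `S = {o, aₗ, aᵣ, t}` of `L`. -/
structure CoveringSquare (L : Type*) [Lattice L] where
  o : L
  al : L
  ar : L
  t : L
  isCoveringSquare : IsCoveringSquare o al ar t

/-- `S` is wide if `t` covers an element other than `aₗ` and `aᵣ`. -/
def CoveringSquare.IsWide {L : Type*} [Lattice L] (S : CoveringSquare L) : Prop :=
  ∃ a : L, a ⋖ S.t ∧ a ≠ S.al ∧ a ≠ S.ar

/-! ### The fork extension `L[S]` -/

section Fork

variable {L : Type*} [Lattice L]

/-- One step down a wing. The pair `p = (y, x)` stands for the prime interval `[y, x]`.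
The step leads from `(y, x)` to `(y', x')` if `{y', x', y, x}` is a covering square of `L` with
bottom `y'` and top `x`. -/
def WingStep (p q : L × L) : Prop := IsCoveringSquare q.1 q.2 p.1 p.2

namespace CoveringSquare

/-- The pairs `(y, x)` of elements of `L` between which a new element is inserted:
`(o, t)` for the new element `m`; the prime intervals `(y, x)` of the wing that starts with
`(o, aₗ)`; and those of the wing that starts with `(o, aᵣ)`. -/
def IsForkPair (S : CoveringSquare L) (p : L × L) : Prop :=
  p = (S.o, S.t) ∨ Relation.ReflTransGen WingStep (S.o, S.al) p ∨
    Relation.ReflTransGen WingStep (S.o, S.ar) p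

theorem lt_of_wing {p q : L × L} (hp : p.1 < p.2)
    (h : Relation.ReflTransGen WingStep p q) : q.1 < q.2 := by
  induction h with
  | refl => exact hp
  | tail _ h _ => exact h.bot_covBy_left.lt

theorem IsForkPair.lt {S : CoveringSquare L} {p : L × L} (h : S.IsForkPair p) : p.1 < p.2 := by
  have hS := S.isCoveringSquare
  rcases h with rfl | h | h
  · exact hS.bot_covBy_left.lt.trans hS.left_covBy_top.lt
  · exact lt_of_wing hS.bot_covBy_left.lt h
  · exact lt_of_wing hS.bot_covBy_right.lt h

end CoveringSquare

/-- The elements of `L[S]`: those of `L`, and one new element for every fork pair `(y, x)`. -/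
inductive ForkExt (S : CoveringSquare L) : Type _
  | old (a : L) : ForkExt S
  | new (p : L × L) (hp : S.IsForkPair p) : ForkExt S

namespace ForkExt

variable {S : CoveringSquare L}

/-- The order of `L[S]`. The new element `z` of the pair `(y, x)` satisfies `y < z < x`, and it is
comparable with the other elements of `L` only through `y` and `x`. New elements are ordered as
their pairs, componentwise: the new elements of one wing form a chain
`z₁ > z₂ > ⋯` that descends along the wing, `m` is above all of them, and new elements of
different wings are incomparable. This is the order generated by that of `L`, the relations
`y < z < x`, those of these two chains, and `z₁ < m < t` for both wings. -/
def Le : ForkExt S → ForkExt S → Prop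
  | old a, old b => a ≤ b
  | old a, new q _ => a ≤ q.1
  | new p _, old b => p.2 ≤ b
  | new p _, new q _ => p ≤ q

instance instPartialOrder : PartialOrder (ForkExt S) where
  le := Le
  le_refl u := by
    cases u <;> exact le_rfl
  le_trans u v w huv hvw := by
    rcases u with a | ⟨p, hp⟩ <;> rcases v with b | ⟨q, hq⟩ <;> rcases w with c | ⟨r, hr⟩ <;>
      simp only [Le] at huv hvw ⊢
    · exact huv.trans hvw
    · exact huv.trans hvw
    · exact huv.trans (hq.lt.le.trans hvw)
    · exact huv.trans hvw.1
    · exact huv.trans hvw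
    · exact ⟨hp.lt.le.trans (huv.trans hvw), huv.trans (hvw.trans hr.lt.le)⟩
    · exact huv.2.trans hvw
    · exact huv.trans hvw
  le_antisymm u v huv hvu := by
    rcases u with a | ⟨p, hp⟩ <;> rcases v with b | ⟨q, hq⟩ <;> simp only [Le] at huv hvu
    · rw [le_antisymm huv hvu]
    · exact absurd (hvu.trans huv) hq.lt.not_ge
    · exact absurd (huv.trans hvu) hp.lt.not_ge
    · obtain rfl := le_antisymm huv hvu
      rfl

/-- The new element `m` between `o` and `t`. -/
def m (S : CoveringSquare L) : ForkExt S := new (S.o, S.t) (Or.inl rfl)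

end ForkExt

end Fork

/-! ### Ordered sets that are lattices -/

/-- An ordered set is a lattice if any two elements have a join and a meet. -/
def IsLatticeOrder (P : Type*) [PartialOrder P] : Prop :=
  ∀ a b : P, (∃ c, IsLUB {a, b} c) ∧ ∃ c, IsGLB {a, b} c

/-- The lattice operations of an ordered set that is a lattice. -/
@[reducible]
noncomputable def IsLatticeOrder.toLattice {P : Type*} [inst : PartialOrder P]
    (h : IsLatticeOrder P) : Lattice P :=
  { inst with
    sup := fun a b => (h a b).1.choose
    le_sup_left := fun a b => (h a b).1.choose_spec.1 (by simp)
    le_sup_right := fun a b => (h a b).1.choose_spec.1 (by simp)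
    sup_le := fun a b c hac hbc => (h a b).1.choose_spec.2 (by
      rintro x (rfl | rfl)
      · exact hac
      · exact hbc)
    inf := fun a b => (h a b).2.choose
    inf_le_left := fun a b => (h a b).2.choose_spec.1 (by simp)
    inf_le_right := fun a b => (h a b).2.choose_spec.1 (by simp)
    le_inf := fun a b c hab hac => (h b c).2.choose_spec.2 (by
      rintro x (rfl | rfl)
      · exact hab
      · exact hac) }

namespace ForkExt

variable {L : Type*} [Lattice L] {S : CoveringSquare L}

/-- `γ(S)`: the congruence `con(m, t)` of the lattice `L[S]`. -/
noncomputable def gamma (h : IsLatticeOrder (ForkExt S)) : @LatticeCon (ForkExt S) h.toLattice :=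
  @LatticeCon.con (ForkExt S) h.toLattice (m S) (old S.t)

/-- The congruence of the lattice `L[S]` generated by the congruence `θ` of `L`. -/
noncomputable def generatedBy (h : IsLatticeOrder (ForkExt S)) (θ : LatticeCon L) :
    @LatticeCon (ForkExt S) h.toLattice :=
  @LatticeCon.generated L _ (ForkExt S) h.toLattice old θ

end ForkExt

/-! Suppose `t` covers some `c` to the right of `aᵣ`. Planarity forces `aₗ ⊓ c ≤ aᵣ`, because the
path from `t` down through `aᵣ` starts between the paths through `aₗ` and `c` (`inf_le_of_leftOf`).
A new element below `m` and `c` lies below `aᵣ`, or below `aₗ ⊓ c ≤ aᵣ`; hence `m ⊓ c ≤ aᵣ` in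
`L[S]`. Now collapsing `aᵣ` with `t` and meeting with `aₗ`, then joining with `m`, collapses `m`
with `t`; conversely, collapsing `m` with `t` and meeting with `c`, then joining with `aᵣ`,
collapses `aᵣ` with `t` (`con_eq_con_of_inf_le`). The left case is symmetric. A third lower cover of
`t` cannot lie between `aₗ` and `aᵣ`: it would contain `o` and produce an `M₃`.

That `L[S]` is a lattice rests on a bound of two upper covers per element, which is the planarity
lemma in the dual diagram combined with semimodularity and slimness. A new element is determined by
its upper end `x`, its lower end being `x ⊓ o`. The bound makes the set of upper ends closed under
joins, both with each other and with elements below `o`; so greatest upper ends, and with them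
meets, exist.

Join-irreducibility holds for the congruence of a prime interval in any lattice. -/

/-! ### Geometry of planar diagrams -/

namespace PlanarDiagram

section Geometry

variable {L : Type*} [PartialOrder L] (D : PlanarDiagram L)

/-- The horizontal displacement per unit of descent along the edge from `t` down to `a`. -/
noncomputable def slope (t a : L) : ℝ :=
  ((D.pos a).1 - (D.pos t).1) / ((D.pos t).2 - (D.pos a).2)

/-- The abscissa at height `h` of the line through `a` and `t`. -/
noncomputable def line (t a : L) (h : ℝ) : ℝ :=
  (D.pos t).1 + D.slope t a * ((D.pos t).2 - h)

theorem line_top (t a : L) : D.line t a (D.pos t).2 = (D.pos t).1 := by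
  simp [line]

theorem line_bot {t a : L} (hat : a < t) : D.line t a (D.pos a).2 = (D.pos a).1 := by
  have := D.height_strictMono a t hat
  have h : (D.pos t).2 - (D.pos a).2 ≠ 0 := by linarith
  rw [line, slope, div_mul_cancel₀ _ h]
  ring

theorem continuous_line (t a : L) : Continuous (D.line t a) := by
  unfold line
  fun_prop

theorem line_mem_segment {t a : L} (hat : a < t) {h : ℝ} (h₁ : (D.pos a).2 ≤ h)
    (h₂ : h ≤ (D.pos t).2) : (D.line t a h, h) ∈ segment ℝ (D.pos a) (D.pos t) := by
  have := D.height_strictMono a t hat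
  have hd : 0 < (D.pos t).2 - (D.pos a).2 := by linarith
  refine ⟨((D.pos t).2 - h) / ((D.pos t).2 - (D.pos a).2),
    (h - (D.pos a).2) / ((D.pos t).2 - (D.pos a).2), div_nonneg (by linarith) hd.le,
    div_nonneg (by linarith) hd.le, ?_, ?_⟩
  · field_simp
    ring
  · ext
    · simp only [line, slope, Prod.fst_add, Prod.smul_fst, smul_eq_mul]
      field_simp
      ring
    · simp only [Prod.snd_add, Prod.smul_snd, smul_eq_mul]
      field_simp
      ring

theorem slope_ne {t a b : L} (ha : a ⋖ t) (hb : b ⋖ t) (hab : a ≠ b) :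
    D.slope t a ≠ D.slope t b := by
  wlog h : (D.pos a).2 ≤ (D.pos b).2 generalizing a b
  -- With equal slopes, the higher of the two lower covers would lie on the edge to the lower one.
  · exact (this hb ha hab.symm (le_of_not_ge h)).symm
  intro hs
  have h₁ : D.pos b ∈ segment ℝ (D.pos a) (D.pos t) := by
    have := D.line_mem_segment ha.lt h (D.height_strictMono b t hb.lt).le
    rwa [line, hs, ← line, D.line_bot hb.lt] at this
  have h₂ := D.edges_noncrossing a t b t ha hb (by simpa using hab)
    ⟨h₁, left_mem_segment ℝ _ _⟩
  rcases h₂.1 with h₂ | h₂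
  · exact hab (D.pos_injective h₂).symm
  · exact hb.lt.ne (D.pos_injective h₂)

theorem leftOf_iff {t a b : L} :
    D.LeftOf t a b ↔ a ⋖ t ∧ b ⋖ t ∧ D.slope t a < D.slope t b :=
  Iff.rfl

theorem leftOf_or {t a b : L} (ha : a ⋖ t) (hb : b ⋖ t) (hab : a ≠ b) :
    D.LeftOf t a b ∨ D.LeftOf t b a := by
  rcases lt_or_gt_of_ne (D.slope_ne ha hb hab) with h | h
  · exact Or.inl ⟨ha, hb, h⟩
  · exact Or.inr ⟨hb, ha, h⟩

/-- The path that runs along edges from `s` up to `a` and then along the edge to `t`. -/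
theorem exists_path [Finite L] {s a t : L} (hsa : s ≤ a) (hat : a ⋖ t) :
    ∃ f : ℝ → ℝ, Continuous f ∧ f (D.pos s).2 = (D.pos s).1 ∧
      (∀ h, (D.pos a).2 ≤ h → f h = D.line t a h) ∧
      ∀ h, (D.pos s).2 ≤ h → h ≤ (D.pos t).2 → ∃ u v : L, u ⋖ v ∧ s ≤ u ∧ u ≤ a ∧
        (v ≤ a ∨ v = t) ∧ (f h, h) ∈ segment ℝ (D.pos u) (D.pos v) := by
  induction a using (wellFounded_lt (α := L)).induction generalizing t with
  | _ a ih =>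
    rcases hsa.eq_or_lt with rfl | hlt
    · exact ⟨D.line t s, D.continuous_line t s, D.line_bot hat.lt, fun _ _ => rfl,
        fun h h₁ h₂ => ⟨s, t, hat, le_rfl, le_rfl, Or.inr rfl, D.line_mem_segment hat.lt h₁ h₂⟩⟩
    · obtain ⟨b, hsb, hba⟩ := exists_le_covBy_of_lt hlt
      obtain ⟨f, hf, hfs, hfa, hfp⟩ := ih b hba.lt hsb hba
      have hfa' : f (D.pos a).2 = (D.pos a).1 := by
        rw [hfa _ (D.height_strictMono b a hba.lt).le, D.line_top]
      refine ⟨fun h => if h ≤ (D.pos a).2 then f h else D.line t a h, ?_, ?_, ?_, ?_⟩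
      · refine Continuous.if_le hf (D.continuous_line t a) continuous_id continuous_const ?_
        rintro h rfl
        exact hfa'.trans (D.line_bot hat.lt).symm
      · simp only [(D.height_strictMono s a hlt).le, if_true, hfs]
      · intro h hh
        simp only
        split_ifs with h'
        · rw [le_antisymm h' hh, hfa', D.line_bot hat.lt]
        · rfl
      · intro h h₁ h₂
        simp only
        split_ifs with h'
        · obtain ⟨u, v, huv, hsu, hub, hv, hm⟩ := hfp h h₁ h'
          exact ⟨u, v, huv, hsu, hub.trans hba.le,
            Or.inl (hv.elim (fun hv => hv.trans hba.le) fun hv => hv.le), hm⟩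
        · exact ⟨a, t, hat, hsa, le_rfl, Or.inr rfl,
            D.line_mem_segment hat.lt (le_of_not_ge h') h₂⟩

/-- Two paths that meet below their common top meet in an element of both. -/
theorem exists_common {t b s : L} {x : ℝ × ℝ} (hx : x.2 < (D.pos t).2)
    {u v u' v' : L} (huv : u ⋖ v) (huv' : u' ⋖ v') (hub : u ≤ b) (hv : v ≤ b ∨ v = t)
    (hsu : s ≤ u') (h : x ∈ segment ℝ (D.pos u) (D.pos v))
    (h' : x ∈ segment ℝ (D.pos u') (D.pos v')) : s ≤ b := by
  -- On a shared edge the lower endpoint already lies between `s` and `b`. Distinct edges meet only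
  -- in a vertex of both, which is not `t` since `x` is lower.
  by_cases he : (u, v) = (u', v')
  · obtain ⟨rfl, rfl⟩ := Prod.mk.inj he
    exact hsu.trans hub
  obtain ⟨h₁, h₂⟩ := D.edges_noncrossing u v u' v' huv huv' he ⟨h, h'⟩
  have h₃ : ∃ w, x = D.pos w ∧ s ≤ w := by
    rcases h₂ with h₂ | h₂
    · exact ⟨u', h₂, hsu⟩
    · exact ⟨v', h₂, hsu.trans huv'.le⟩
  obtain ⟨w, rfl, hsw⟩ := h₃
  rcases h₁ with h₁ | h₁
  · exact (hsw.trans (D.pos_injective h₁).le).trans hub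
  · obtain rfl := D.pos_injective h₁
    rcases hv with hv | rfl
    · exact hsw.trans hv
    · exact absurd hx (lt_irrefl _)

end Geometry

section Lattice

variable {L : Type*} [Lattice L] [Finite L] (D : PlanarDiagram L)

/-- A lower cover between two others contains their meet. -/
theorem inf_le_of_leftOf {t a b c : L} (hab : D.LeftOf t a b) (hbc : D.LeftOf t b c) :
    a ⊓ c ≤ b := by
  obtain ⟨ha, hb, hsab⟩ := D.leftOf_iff.1 hab
  obtain ⟨-, hc, hsbc⟩ := D.leftOf_iff.1 hbc
  obtain ⟨p, hp, hp₀, hp₁, hpe⟩ := D.exists_path (inf_le_left : a ⊓ c ≤ a) ha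
  obtain ⟨q, hq, hq₀, hq₁, hqe⟩ := D.exists_path (inf_le_right : a ⊓ c ≤ c) hc
  obtain ⟨r, hr, -, hr₁, hre⟩ := D.exists_path (inf_le_right : (a ⊓ c) ⊓ b ≤ b) hb
  have mono : ∀ {x y : L}, x ≤ y → (D.pos x).2 ≤ (D.pos y).2 := fun h =>
    (StrictMono.monotone (f := fun x => (D.pos x).2) fun _ _ => D.height_strictMono _ _) h
  -- At height `k` all three paths run along their last edges, so the slopes at `t` order them.
  obtain ⟨k, hka, hkb, hkc, hkt⟩ : ∃ k, (D.pos a).2 ≤ k ∧ (D.pos b).2 ≤ k ∧ (D.pos c).2 ≤ k ∧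
      k < (D.pos t).2 :=
    ⟨max (D.pos a).2 (max (D.pos b).2 (D.pos c).2), le_max_left _ _,
      (le_max_left _ _).trans (le_max_right _ _), (le_max_right _ _).trans (le_max_right _ _),
      max_lt (D.height_strictMono _ _ ha.lt)
        (max_lt (D.height_strictMono _ _ hb.lt) (D.height_strictMono _ _ hc.lt))⟩
  have hsk : (D.pos (a ⊓ c)).2 ≤ k := (mono inf_le_left).trans hka
  have hpr : p k < r k := by
    rw [hp₁ k hka, hr₁ k hkb, line, line]
    nlinarith
  have hrq : r k < q k := by
    rw [hq₁ k hkc, hr₁ k hkb, line, line]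
    nlinarith
  -- The outer paths both start at `a ⊓ c`, while at height `k` the middle one is strictly between
  -- them. So it must cross `p` if it passes `a ⊓ c` on the left, and `q` if on the right.
  rcases le_total (r (D.pos (a ⊓ c)).2) (D.pos (a ⊓ c)).1 with h | h
  · obtain ⟨z, ⟨hz₁, hz₂⟩, hz⟩ := intermediate_value_Icc hsk (hr.sub hp).continuousOn
      (show (0 : ℝ) ∈ _ from ⟨by simp only [Pi.sub_apply, hp₀]; linarith,
        by simp only [Pi.sub_apply]; linarith⟩)
    have hz : r z = p z := sub_eq_zero.1 hz
    have hzt := hz₂.trans_lt hkt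
    obtain ⟨u, v, huv, -, hub, hv, hm⟩ := hre z ((mono inf_le_left).trans hz₁) hzt.le
    obtain ⟨u', v', huv', hsu, -, -, hm'⟩ := hpe z hz₁ hzt.le
    rw [← hz] at hm'
    exact D.exists_common (x := (r z, z)) hzt huv huv' hub hv hsu hm hm'
  · obtain ⟨z, ⟨hz₁, hz₂⟩, hz⟩ := intermediate_value_Icc hsk (hq.sub hr).continuousOn
      (show (0 : ℝ) ∈ _ from ⟨by simp only [Pi.sub_apply, hq₀]; linarith,
        by simp only [Pi.sub_apply]; linarith⟩)
    have hz : q z = r z := sub_eq_zero.1 hz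
    have hzt := hz₂.trans_lt hkt
    obtain ⟨u, v, huv, -, hub, hv, hm⟩ := hre z ((mono inf_le_left).trans hz₁) hzt.le
    obtain ⟨u', v', huv', hsu, -, -, hm'⟩ := hqe z hz₁ hzt.le
    rw [hz] at hm'
    exact D.exists_common (x := (r z, z)) hzt huv huv' hub hv hsu hm hm'

end Lattice

/-- Reflecting a segment in the horizontal axis. -/
theorem reflect_mem_segment {x p q : ℝ × ℝ} (h : x ∈ segment ℝ (p.1, -p.2) (q.1, -q.2)) :
    (x.1, -x.2) ∈ segment ℝ p q := by
  obtain ⟨c, d, hc, hd, hcd, rfl⟩ := h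
  refine ⟨c, d, hc, hd, hcd, ?_⟩
  ext
  · simp
  · simp
    ring

/-- The diagram of the dual order, turned upside down. -/
noncomputable def dual {L : Type*} [PartialOrder L] (D : PlanarDiagram L) : PlanarDiagram Lᵒᵈ where
  pos x := ((D.pos (OrderDual.ofDual x)).1, -(D.pos (OrderDual.ofDual x)).2)
  pos_injective x y h := by
    simp only [Prod.mk.injEq, neg_inj] at h
    exact D.pos_injective (Prod.ext h.1 h.2)
  height_strictMono a b h := neg_lt_neg (D.height_strictMono _ _ h)
  edges_noncrossing a b c d hab hcd hne := by
    rintro x ⟨h₁, h₂⟩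
    rw [segment_symm] at h₁ h₂
    have key := D.edges_noncrossing _ _ _ _ hab.ofDual hcd.ofDual
      (fun h => hne (by
        obtain ⟨h, h'⟩ := Prod.mk.inj h
        exact Prod.ext h' h)) ⟨reflect_mem_segment h₁, reflect_mem_segment h₂⟩
    have aux : ∀ y : L, (x.1, -x.2) = D.pos y → x = ((D.pos y).1, -(D.pos y).2) := by
      intro y hy
      rw [← hy]
      simp
    exact ⟨key.1.symm.imp (aux _) (aux _), key.2.symm.imp (aux _) (aux _)⟩

end PlanarDiagram

/-! ### Slim semimodular lattices -/

section Slim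

variable {L : Type*} [Lattice L]

/-- Two elements that cover a third one meet in it. -/
theorem CovBy.inf_eq_of_ne {p a b : L} (ha : p ⋖ a) (hb : p ⋖ b) (hab : a ≠ b) : a ⊓ b = p := by
  refine (ha.eq_or_eq (le_inf ha.le hb.le) inf_le_left).resolve_right fun h => ?_
  exact (hb.eq_or_eq ha.le (inf_eq_left.1 h)).elim (fun h => ha.lt.ne' h) hab

theorem CovBy.sup_eq_of_ne {t a b : L} (ha : a ⋖ t) (hb : b ⋖ t) (hab : a ≠ b) : a ⊔ b = t := by
  refine (ha.eq_or_eq le_sup_left (sup_le ha.le hb.le)).resolve_left fun h => ?_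
  exact (hb.eq_or_eq (sup_eq_left.1 h) ha.le).elim hab fun h => ha.lt.ne h

variable [Finite L] [IsUpperModularLattice L]

/-- The dual planarity lemma puts the middle cover `b` below `a ⊔ c`. By semimodularity `a ⊔ c`
covers `a` and `c`, so all pairwise joins equal it and `a`, `b`, `c` form an `M₃`. -/
theorem IsSlim.false_of_leftOf_dual (hL : IsSlim L) (D : PlanarDiagram L) {p a b c : L}
    (h₁ : D.dual.LeftOf (OrderDual.toDual p) (OrderDual.toDual a) (OrderDual.toDual b))
    (h₂ : D.dual.LeftOf (OrderDual.toDual p) (OrderDual.toDual b) (OrderDual.toDual c)) :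
    False := by
  have hb : b ≤ a ⊔ c := D.dual.inf_le_of_leftOf h₁ h₂
  have hpa : p ⋖ a := h₁.1.ofDual
  have hpb : p ⋖ b := h₁.2.1.ofDual
  have hpc : p ⋖ c := h₂.2.1.ofDual
  have hab : a ≠ b := by
    rintro rfl
    exact lt_irrefl _ h₁.2.2
  have hbc : b ≠ c := by
    rintro rfl
    exact lt_irrefl _ h₂.2.2
  have hac : a ≠ c := by
    rintro rfl
    exact lt_asymm h₁.2.2 h₂.2.2
  have iab := hpa.inf_eq_of_ne hpb hab
  have iac := hpa.inf_eq_of_ne hpc hac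
  have ibc := hpb.inf_eq_of_ne hpc hbc
  have ca : a ⋖ a ⊔ c := by
    rw [sup_comm]
    exact covBy_sup_of_inf_covBy_left (by rwa [inf_comm, iac])
  have cc : c ⋖ a ⊔ c := covBy_sup_of_inf_covBy_left (by rwa [iac])
  have sab : a ⊔ b = a ⊔ c :=
    (ca.eq_or_eq le_sup_left (sup_le le_sup_left hb)).resolve_left fun h =>
      (hpa.eq_or_eq hpb.le (sup_eq_left.1 h)).elim (fun h => hpb.lt.ne' h) hab.symm
  have sbc : b ⊔ c = a ⊔ c :=
    (cc.eq_or_eq le_sup_right (sup_le hb le_sup_right)).resolve_left fun h =>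
      (hpc.eq_or_eq hpb.le (sup_eq_right.1 h)).elim (fun h => hpb.lt.ne' h) hbc
  exact hL ⟨a, b, c, hab, hac, hbc, iab.trans iac.symm, iab.trans ibc.symm, sab,
    sab.trans sbc.symm⟩

/-- In a slim planar semimodular lattice an element has at most two upper covers. -/
theorem IsSlim.eq_or_eq_of_covBy (hL : IsSlim L) (D : PlanarDiagram L) {p a b c : L}
    (ha : p ⋖ a) (hb : p ⋖ b) (hc : p ⋖ c) (hab : a ≠ b) : c = a ∨ c = b := by
  by_contra! h
  have key : ∀ {x y : L}, p ⋖ x → p ⋖ y → x ≠ y → _ := fun hx hy hxy =>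
    D.dual.leftOf_or hx.toDual hy.toDual (OrderDual.toDual.injective.ne hxy)
  rcases key ha hb hab with h₁ | h₁ <;> rcases key hb hc h.2.symm with h₂ | h₂ <;>
    rcases key ha hc h.1.symm with h₃ | h₃
  -- However the three pairs are oriented, two of the relations can be chained.
  all_goals first
    | exact hL.false_of_leftOf_dual D h₁ h₂
    | exact hL.false_of_leftOf_dual D h₂ h₁
    | exact hL.false_of_leftOf_dual D h₁ h₃
    | exact hL.false_of_leftOf_dual D h₃ h₁
    | exact hL.false_of_leftOf_dual D h₂ h₃
    | exact hL.false_of_leftOf_dual D h₃ h₂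

end Slim

/-! ### The fork extension is a lattice -/

namespace CoveringSquare

section Wings

variable {L : Type*} [Lattice L] (S : CoveringSquare L)

/-- The upper ends of the fork pairs. -/
def IsForkTop (x : L) : Prop := S.IsForkPair (x ⊓ S.o, x)

variable {S}

theorem bot_le_top : S.o ≤ S.t :=
  S.isCoveringSquare.bot_covBy_left.le.trans S.isCoveringSquare.left_covBy_top.le

/-- The wing that descends from `(o, a)`: its pairs are `(x ⊓ o, x)` with `x ≤ a`. -/
theorem wing_spec {a : L} (ha : S.o ⋖ a) {p : L × L}
    (h : Relation.ReflTransGen WingStep (S.o, a) p) :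
    p.1 = p.2 ⊓ S.o ∧ p.2 ≤ a ∧ (p = (S.o, a) ∨ ∃ q : L × L,
      Relation.ReflTransGen WingStep (S.o, a) q ∧ WingStep q p) := by
  induction h with
  | refl => exact ⟨(inf_eq_right.2 ha.le).symm, le_rfl, Or.inl rfl⟩
  | @tail q p hq h ih =>
    refine ⟨le_antisymm ?_ ?_, h.left_covBy_top.le.trans ih.2.1,
      Or.inr ⟨q, hq, h⟩⟩
    · exact le_inf h.bot_covBy_left.le
        (h.bot_covBy_right.le.trans (ih.1.le.trans inf_le_right))
    -- The lower end is `p.2 ⊓ q.1` with `q.1 = q.2 ⊓ o` and `p.2 ≤ q.2`.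
    · rw [← h.inf_eq, ih.1]
      exact le_inf inf_le_left (inf_le_inf_right _ h.left_covBy_top.le)

theorem IsForkPair.fst_eq {p : L × L} (h : S.IsForkPair p) : p.1 = p.2 ⊓ S.o := by
  rcases h with rfl | h | h
  · exact (inf_eq_right.2 bot_le_top).symm
  · exact (wing_spec S.isCoveringSquare.bot_covBy_left h).1
  · exact (wing_spec S.isCoveringSquare.bot_covBy_right h).1

theorem IsForkPair.isForkTop {p : L × L} (h : S.IsForkPair p) : S.IsForkTop p.2 := by
  rw [IsForkTop, ← h.fst_eq]
  exact h

theorem IsForkPair.eq_or_le {p : L × L} (h : S.IsForkPair p) :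
    p.2 = S.t ∨ p.2 ≤ S.al ∨ p.2 ≤ S.ar := by
  rcases h with rfl | h | h
  · exact Or.inl rfl
  · exact Or.inr (Or.inl (wing_spec S.isCoveringSquare.bot_covBy_left h).2.1)
  · exact Or.inr (Or.inr (wing_spec S.isCoveringSquare.bot_covBy_right h).2.1)

theorem isForkTop_top : S.IsForkTop S.t :=
  IsForkPair.isForkTop (p := (S.o, S.t)) (Or.inl rfl)

theorem IsForkTop.not_le {x : L} (h : S.IsForkTop x) : ¬ x ≤ S.o := fun hx =>
  h.lt.ne (inf_eq_left.2 hx)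

theorem IsForkTop.le_top {x : L} (h : S.IsForkTop x) : x ≤ S.t := by
  rcases h.eq_or_le with h | h | h
  · exact h.le
  · exact h.trans S.isCoveringSquare.left_covBy_top.le
  · exact h.trans S.isCoveringSquare.right_covBy_top.le

/-- A fork pair either lies over `o`, or hangs below another fork pair by a covering square. -/
theorem IsForkTop.step {x : L} (h : S.IsForkTop x) :
    (S.o ≤ x ∧ (x = S.t ∨ x = S.al ∨ x = S.ar)) ∨
      ∃ y ≤ S.o, x ⊓ S.o ⋖ x ∧ x ⊓ S.o ⋖ y ∧ S.IsForkTop (x ⊔ y) := by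
  have hS := S.isCoveringSquare
  have aux : ∀ {q : L × L}, S.IsForkPair q → WingStep q (x ⊓ S.o, x) →
      ∃ y ≤ S.o, x ⊓ S.o ⋖ x ∧ x ⊓ S.o ⋖ y ∧ S.IsForkTop (x ⊔ y) := fun {q} hq hs =>
    ⟨q.1, hq.fst_eq.le.trans inf_le_right, hs.bot_covBy_left, hs.bot_covBy_right, by
      have := hs.sup_eq
      simp only at this
      rw [this]
      exact hq.isForkTop⟩
  rcases h with h | h | h
  · obtain rfl : x = S.t := (Prod.mk.inj h).2
    exact Or.inl ⟨bot_le_top, Or.inl rfl⟩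
  · rcases (wing_spec hS.bot_covBy_left h).2.2 with h | ⟨q, hq, hs⟩
    · obtain rfl : x = S.al := (Prod.mk.inj h).2
      exact Or.inl ⟨hS.bot_covBy_left.le, Or.inr (Or.inl rfl)⟩
    · exact Or.inr (aux (Or.inr (Or.inl hq)) hs)
  · rcases (wing_spec hS.bot_covBy_right h).2.2 with h | ⟨q, hq, hs⟩
    · obtain rfl : x = S.ar := (Prod.mk.inj h).2
      exact Or.inl ⟨hS.bot_covBy_right.le, Or.inr (Or.inr rfl)⟩
    · exact Or.inr (aux (Or.inr (Or.inr hq)) hs)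

end Wings

section Joins

variable {L : Type*} [Lattice L] [Finite L] {S : CoveringSquare L}

/-- Climbing the wing: unless `u ≤ x`, the fork pair of `x` hangs below that of some `x ⊔ y` with `y
≤ o` covering `x ⊓ o`. As `x` and `y` are the only upper covers of `x ⊓ o`, also `y ≤ (x ⊓ o) ⊔ u`,
so replacing `x` by `x ⊔ y` does not change the join with `u`. -/
theorem IsForkTop.sup_of_le
    (h₂ : ∀ {p a b c : L}, p ⋖ a → p ⋖ b → p ⋖ c → a ≠ b → c = a ∨ c = b)
    {x u : L} (hx : S.IsForkTop x) (hu : u ≤ S.o) : S.IsForkTop (x ⊔ u) := by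
  induction x using (wellFounded_gt (α := L)).induction with
  | _ x ih =>
    by_cases hux : u ≤ x
    · rwa [sup_eq_left.2 hux]
    rcases hx.step with ⟨h, -⟩ | ⟨y, hyo, hcx, hcy, hy⟩
    · exact absurd (hu.trans h) hux
    obtain ⟨w, hw, hwu⟩ := exists_covBy_le_of_lt
      (left_lt_sup.2 fun h => hux (h.trans inf_le_left) : x ⊓ S.o < x ⊓ S.o ⊔ u)
    have hxy : x ≠ y := fun h => hx.not_le (h.le.trans hyo)
    have hwy : w = y := (h₂ hcx hcy hw hxy).resolve_left fun h =>
      hx.not_le (h.ge.trans (hwu.trans (sup_le inf_le_right hu)))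
    subst hwy
    have hlt : x < x ⊔ w := left_lt_sup.2 fun h =>
      (hcy.lt.not_ge (le_inf h hyo))
    have key := ih _ hlt hy
    rwa [sup_assoc, sup_comm w u, ← sup_assoc,
      sup_eq_left.2 (hwu.trans (sup_le_sup_right inf_le_left u))] at key

theorem IsForkTop.sup
    (h₂ : ∀ {p a b c : L}, p ⋖ a → p ⋖ b → p ⋖ c → a ≠ b → c = a ∨ c = b)
    {x y : L} (hx : S.IsForkTop x) (hy : S.IsForkTop y) : S.IsForkTop (x ⊔ y) := by
  have hS := S.isCoveringSquare
  -- Joining both with `(x ⊔ y) ⊓ o` keeps them upper ends and keeps their join. Afterwards the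
  -- lower ends agree, and away from `o` the two-cover bound leaves only `x = y`.
  wlog h : x ⊓ S.o = (x ⊔ y) ⊓ S.o ∧ y ⊓ S.o = (x ⊔ y) ⊓ S.o generalizing x y
  · have aux : ∀ z ≤ x ⊔ y,
        (z ⊔ (x ⊔ y) ⊓ S.o) ⊓ S.o = (x ⊔ y) ⊓ S.o := fun z hz =>
      le_antisymm (inf_le_inf_right _ (sup_le hz inf_le_left)) (le_inf le_sup_right inf_le_right)
    have e : (x ⊔ (x ⊔ y) ⊓ S.o) ⊔ (y ⊔ (x ⊔ y) ⊓ S.o) = x ⊔ y := by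
      rw [← sup_sup_distrib_right, sup_eq_left.2 inf_le_left]
    have key := this (hx.sup_of_le h₂ (inf_le_right : (x ⊔ y) ⊓ S.o ≤ S.o))
      (hy.sup_of_le h₂ (inf_le_right : (x ⊔ y) ⊓ S.o ≤ S.o))
      (by rw [e]; exact ⟨aux x le_sup_left, aux y le_sup_right⟩)
    rwa [e] at key
  have h : x ⊓ S.o = y ⊓ S.o := h.1.trans h.2.symm
  rcases hx.step with ⟨hox, hx'⟩ | ⟨z, hzo, hcx, hcz, -⟩
  · rcases hy.step with ⟨-, hy'⟩ | ⟨z, hzo, -, hcz, -⟩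
    · have ht := isForkTop_top (S := S)
      have hxt := hx.le_top
      have hyt := hy.le_top
      rcases hx' with rfl | rfl | rfl
      · rwa [sup_eq_left.2 hyt]
      · rcases hy' with rfl | rfl | rfl
        · rwa [sup_eq_right.2 hxt]
        · rwa [sup_idem]
        · rwa [hS.sup_eq]
      · rcases hy' with rfl | rfl | rfl
        · rwa [sup_eq_right.2 hxt]
        · rwa [sup_comm, hS.sup_eq]
        · rwa [sup_idem]
    · rw [← h, inf_eq_right.2 hox] at hcz
      exact absurd hzo hcz.lt.not_ge
  · rcases hy.step with ⟨hoy, -⟩ | ⟨-, -, hcy, -, -⟩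
    · rw [h, inf_eq_right.2 hoy] at hcz
      exact absurd hzo hcz.lt.not_ge
    · rw [← h] at hcy
      have hxz : x ≠ z := fun h => hx.not_le (h.le.trans hzo)
      obtain rfl := (h₂ hcx hcz hcy hxz).resolve_right fun h => hy.not_le (h.le.trans hzo)
      rwa [sup_idem]

/-- The greatest upper end of a fork pair below a given element. -/
theorem exists_greatest_isForkTop
    (h₂ : ∀ {p a b c : L}, p ⋖ a → p ⋖ b → p ⋖ c → a ≠ b → c = a ∨ c = b)
    {x z : L} (hx : S.IsForkTop x) (hxz : x ≤ z) :
    ∃ y, S.IsForkTop y ∧ y ≤ z ∧ (∀ w, S.IsForkTop w → w ≤ z → w ≤ y) ∧ z ⊓ S.o ≤ y := by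
  obtain ⟨y, hy⟩ := Set.Finite.exists_maximal (Set.toFinite {y | S.IsForkTop y ∧ y ≤ z})
    ⟨x, hx, hxz⟩
  refine ⟨y, hy.prop.1, hy.prop.2, fun w hw hwz => ?_, ?_⟩
  · exact le_sup_left.trans (hy.2 ⟨hw.sup h₂ hy.prop.1, sup_le hwz hy.prop.2⟩ le_sup_right)
  · exact le_sup_right.trans (hy.2 ⟨hy.prop.1.sup_of_le h₂ (inf_le_right : z ⊓ S.o ≤ S.o),
      sup_le hy.prop.2 inf_le_left⟩ le_sup_left)

end Joins

end CoveringSquare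

section Pairs

variable {P : Type*} [PartialOrder P] {a b c : P}

theorem isLUB_pair_of (ha : a ≤ c) (hb : b ≤ c) (h : ∀ d, a ≤ d → b ≤ d → c ≤ d) :
    IsLUB {a, b} c :=
  ⟨by simp [upperBounds_insert, ha, hb], fun d hd => h d (hd (by simp)) (hd (by simp))⟩

theorem isGLB_pair_of (ha : c ≤ a) (hb : c ≤ b) (h : ∀ d, d ≤ a → d ≤ b → d ≤ c) :
    IsGLB {a, b} c :=
  ⟨by simp [lowerBounds_insert, ha, hb], fun d hd => h d (hd (by simp)) (hd (by simp))⟩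

theorem isGLB_pair_iff : IsGLB {a, b} c ↔ ∀ d, d ≤ c ↔ d ≤ a ∧ d ≤ b := by
  simp [isGLB_iff_le_iff, lowerBounds_insert]

end Pairs

/-! ### Joins and meets in the fork extension -/

namespace ForkExt

section Order

variable {L : Type*} [Lattice L] {S : CoveringSquare L}

/-- The new element below `x`. -/
def newTop {x : L} (hx : S.IsForkTop x) : ForkExt S := new (x ⊓ S.o, x) hx

theorem eq_old_or_newTop (u : ForkExt S) :
    (∃ a, u = old a) ∨ ∃ x, ∃ hx : S.IsForkTop x, u = newTop hx := by
  rcases u with a | ⟨⟨y, x⟩, hp⟩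
  · exact Or.inl ⟨a, rfl⟩
  · obtain rfl : y = x ⊓ S.o := hp.fst_eq
    exact Or.inr ⟨x, hp, rfl⟩

theorem old_le_old {a b : L} : (old a : ForkExt S) ≤ old b ↔ a ≤ b := Iff.rfl

theorem old_le_newTop {a x : L} {hx : S.IsForkTop x} :
    old a ≤ newTop hx ↔ a ≤ x ∧ a ≤ S.o :=
  show a ≤ x ⊓ S.o ↔ _ from le_inf_iff

theorem newTop_le_old {a x : L} {hx : S.IsForkTop x} : newTop hx ≤ old a ↔ x ≤ a := Iff.rfl

theorem newTop_le_newTop {x y : L} {hx : S.IsForkTop x} {hy : S.IsForkTop y} :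
    newTop hx ≤ newTop hy ↔ x ≤ y :=
  ⟨fun h => h.2, fun h => ⟨inf_le_inf_right _ h, h⟩⟩

theorem m_eq : m S = newTop (S := S) CoveringSquare.isForkTop_top := by
  unfold m newTop
  congr
  exact (inf_eq_right.2 CoveringSquare.bot_le_top).symm

theorem isLUB_old (a b : L) : IsLUB {old a, old b} (old (a ⊔ b) : ForkExt S) := by
  refine isLUB_pair_of le_sup_left le_sup_right fun u ha hb => ?_
  rcases eq_old_or_newTop u with ⟨c, rfl⟩ | ⟨x, hx, rfl⟩
  · exact old_le_old.2 (sup_le ha hb)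
  · rw [old_le_newTop] at ha hb ⊢
    exact ⟨sup_le ha.1 hb.1, sup_le ha.2 hb.2⟩

theorem isGLB_old (a b : L) : IsGLB {old a, old b} (old (a ⊓ b) : ForkExt S) := by
  refine isGLB_pair_of inf_le_left inf_le_right fun u ha hb => ?_
  rcases eq_old_or_newTop u with ⟨c, rfl⟩ | ⟨x, hx, rfl⟩
  · exact old_le_old.2 (le_inf ha hb)
  · exact newTop_le_old.2 (le_inf ha hb)

/-- No new element lies above `aₗ`, since the old elements below a new one are all below `o`. -/
theorem isLUB_m_left : IsLUB {m S, old S.al} (old S.t) := by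
  have hS := S.isCoveringSquare
  rw [m_eq]
  refine isLUB_pair_of (newTop_le_old.2 le_rfl) (old_le_old.2 hS.left_covBy_top.le)
    fun u hm ha => ?_
  rcases eq_old_or_newTop u with ⟨c, rfl⟩ | ⟨x, hx, rfl⟩
  · exact hm
  · exact absurd (old_le_newTop.1 ha).2 hS.bot_covBy_left.lt.not_ge

theorem isLUB_m_right : IsLUB {m S, old S.ar} (old S.t) := by
  have hS := S.isCoveringSquare
  rw [m_eq]
  refine isLUB_pair_of (newTop_le_old.2 le_rfl) (old_le_old.2 hS.right_covBy_top.le)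
    fun u hm ha => ?_
  rcases eq_old_or_newTop u with ⟨c, rfl⟩ | ⟨x, hx, rfl⟩
  · exact hm
  · exact absurd (old_le_newTop.1 ha).2 hS.bot_covBy_right.lt.not_ge

theorem old_bot_le_m : old S.o ≤ m S := le_refl S.o

/-- This gives `m ⊓ c ≤ aᵣ` in `L[S]`: of the new elements only those of the left wing need an
argument, and below `c` their upper ends are under `aₗ ⊓ c`. -/
theorem le_old_right {c : L} (hc : ¬ S.t ≤ c) (h : S.al ⊓ c ≤ S.ar) {u : ForkExt S}
    (hm : u ≤ m S) (huc : u ≤ old c) : u ≤ old S.ar := by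
  rw [m_eq] at hm
  rcases eq_old_or_newTop u with ⟨a, rfl⟩ | ⟨x, hx, rfl⟩
  · exact old_le_old.2 ((old_le_newTop.1 hm).2.trans S.isCoveringSquare.bot_covBy_right.le)
  · rw [newTop_le_old] at huc ⊢
    rcases hx.eq_or_le with hx | hx | hx
    · exact absurd (hx.ge.trans huc) hc
    · exact (le_inf hx huc).trans h
    · exact hx

theorem le_old_left {c : L} (hc : ¬ S.t ≤ c) (h : c ⊓ S.ar ≤ S.al) {u : ForkExt S}
    (hm : u ≤ m S) (huc : u ≤ old c) : u ≤ old S.al := by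
  rw [m_eq] at hm
  rcases eq_old_or_newTop u with ⟨a, rfl⟩ | ⟨x, hx, rfl⟩
  · exact old_le_old.2 ((old_le_newTop.1 hm).2.trans S.isCoveringSquare.bot_covBy_left.le)
  · rw [newTop_le_old] at huc ⊢
    rcases hx.eq_or_le with hx | hx | hx
    · exact absurd (hx.ge.trans huc) hc
    · exact hx
    · exact (le_inf huc hx).trans h

variable [Finite L]

/-- The join is new exactly when `a ≤ o`; otherwise no new element lies above `a`. -/
theorem exists_isLUB_old_newTop
    (h₂ : ∀ {p a b c : L}, p ⋖ a → p ⋖ b → p ⋖ c → a ≠ b → c = a ∨ c = b)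
    (a : L) {x : L} (hx : S.IsForkTop x) : ∃ u, IsLUB {old a, newTop hx} u := by
  by_cases hao : a ≤ S.o
  · refine ⟨newTop (hx.sup_of_le h₂ hao), isLUB_pair_of (old_le_newTop.2 ⟨le_sup_right, hao⟩)
      (newTop_le_newTop.2 le_sup_left) fun u ha hu => ?_⟩
    rcases eq_old_or_newTop u with ⟨c, rfl⟩ | ⟨y, hy, rfl⟩
    · exact newTop_le_old.2 (sup_le hu ha)
    · exact newTop_le_newTop.2 (sup_le (newTop_le_newTop.1 hu) (old_le_newTop.1 ha).1)
  · refine ⟨old (a ⊔ x), isLUB_pair_of (old_le_old.2 le_sup_left)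
      (newTop_le_old.2 le_sup_right) fun u ha hu => ?_⟩
    rcases eq_old_or_newTop u with ⟨c, rfl⟩ | ⟨y, hy, rfl⟩
    · exact old_le_old.2 (sup_le ha hu)
    · exact absurd (old_le_newTop.1 ha).2 hao

/-- Among the old elements below `z` and `o` and the new elements below `z` there is a greatest
one. -/
theorem exists_greatest_le
    (h₂ : ∀ {p a b c : L}, p ⋖ a → p ⋖ b → p ⋖ c → a ≠ b → c = a ∨ c = b) (z : L) :
    ∃ u : ForkExt S, (∀ a, old a ≤ u ↔ a ≤ z ∧ a ≤ S.o) ∧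
      ∀ x, ∀ hx : S.IsForkTop x, newTop hx ≤ u ↔ x ≤ z := by
  by_cases h : ∃ x, S.IsForkTop x ∧ x ≤ z
  · obtain ⟨x, hx, hxz⟩ := h
    obtain ⟨y, hy, hyz, hmax, hz⟩ := CoveringSquare.exists_greatest_isForkTop h₂ hx hxz
    refine ⟨newTop hy, fun a => ?_, fun w hw => ?_⟩
    · rw [old_le_newTop]
      exact ⟨fun h => ⟨h.1.trans hyz, h.2⟩, fun h => ⟨(le_inf h.1 h.2).trans hz, h.2⟩⟩
    · rw [newTop_le_newTop]
      exact ⟨fun h => h.trans hyz, hmax w hw⟩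
  · refine ⟨old (z ⊓ S.o), fun a => ?_, fun w hw => ?_⟩
    · rw [old_le_old, le_inf_iff]
    · rw [newTop_le_old]
      exact ⟨fun h => h.trans inf_le_left, fun hwz => absurd ⟨w, hw, hwz⟩ h⟩

theorem exists_isGLB_old_newTop
    (h₂ : ∀ {p a b c : L}, p ⋖ a → p ⋖ b → p ⋖ c → a ≠ b → c = a ∨ c = b)
    (a : L) {x : L} (hx : S.IsForkTop x) : ∃ u, IsGLB {old a, newTop hx} u := by
  -- Old lower bounds of `newTop hx` must lie below `o`, so the common lower bounds are exactly the
  -- elements considered for `z = a ⊓ x`.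
  obtain ⟨u, ho, hn⟩ := exists_greatest_le (S := S) h₂ (a ⊓ x)
  refine ⟨u, isGLB_pair_iff.2 fun v => ?_⟩
  rcases eq_old_or_newTop v with ⟨c, rfl⟩ | ⟨y, hy, rfl⟩
  · rw [ho, old_le_old, old_le_newTop, le_inf_iff, and_assoc]
  · rw [hn, newTop_le_old, newTop_le_newTop, le_inf_iff]

theorem exists_isGLB_newTop
    (h₂ : ∀ {p a b c : L}, p ⋖ a → p ⋖ b → p ⋖ c → a ≠ b → c = a ∨ c = b)
    {x y : L} (hx : S.IsForkTop x) (hy : S.IsForkTop y) :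
    ∃ u, IsGLB {newTop hx, newTop hy} u := by
  obtain ⟨u, ho, hn⟩ := exists_greatest_le (S := S) h₂ (x ⊓ y)
  refine ⟨u, isGLB_pair_iff.2 fun v => ?_⟩
  rcases eq_old_or_newTop v with ⟨c, rfl⟩ | ⟨w, hw, rfl⟩
  · rw [ho, old_le_newTop, old_le_newTop, le_inf_iff]
    tauto
  · rw [hn, newTop_le_newTop, newTop_le_newTop, le_inf_iff]

theorem isLatticeOrder
    (h₂ : ∀ {p a b c : L}, p ⋖ a → p ⋖ b → p ⋖ c → a ≠ b → c = a ∨ c = b) :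
    IsLatticeOrder (ForkExt S) := by
  intro u v
  rcases eq_old_or_newTop u with ⟨a, rfl⟩ | ⟨x, hx, rfl⟩ <;>
    rcases eq_old_or_newTop v with ⟨b, rfl⟩ | ⟨y, hy, rfl⟩
  · exact ⟨⟨_, isLUB_old a b⟩, _, isGLB_old a b⟩
  · exact ⟨exists_isLUB_old_newTop h₂ a hy, exists_isGLB_old_newTop h₂ a hy⟩
  · rw [Set.pair_comm]
    exact ⟨exists_isLUB_old_newTop h₂ b hx, exists_isGLB_old_newTop h₂ b hx⟩
  · refine ⟨⟨newTop (hx.sup h₂ hy), isLUB_pair_of (newTop_le_newTop.2 le_sup_left)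
      (newTop_le_newTop.2 le_sup_right) fun u hu hv => ?_⟩, exists_isGLB_newTop h₂ hx hy⟩
    rcases eq_old_or_newTop u with ⟨c, rfl⟩ | ⟨w, hw, rfl⟩
    · exact newTop_le_old.2 (sup_le hu hv)
    · exact newTop_le_newTop.2 (sup_le (newTop_le_newTop.1 hu) (newTop_le_newTop.1 hv))

end Order

end ForkExt

/-! ### Congruences generated by prime intervals -/

namespace LatticeCon

section Generation

variable {α : Type*} [Lattice α]

theorem r_con (a b : α) : (con a b).r a b := fun _ h => h

theorem con_le {a b : α} {θ : LatticeCon α} (h : θ.r a b) : con a b ≤ θ := fun _ _ hxy => hxy θ h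

/-- The preimage of a congruence under a lattice homomorphism. -/
def comap {β : Type*} [Lattice β] (f : α → β) (hi : ∀ x y, f (x ⊓ y) = f x ⊓ f y)
    (hs : ∀ x y, f (x ⊔ y) = f x ⊔ f y) (θ : LatticeCon β) : LatticeCon α where
  r x y := θ.r (f x) (f y)
  iseqv :=
    { refl := fun x => θ.iseqv.refl (f x)
      symm := fun h => θ.iseqv.symm h
      trans := fun h h' => θ.iseqv.trans h h' }
  inf h h' := by
    rw [hi, hi]
    exact θ.inf h h'
  sup h h' := by
    rw [hs, hs]
    exact θ.sup h h'

/-- The pullback of `con (f a) (f b)` along the homomorphism `f` is a congruence collapsing `a` and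
`b`, so it contains `con a b`. -/
theorem generated_con {β : Type*} [Lattice β] (f : α → β) (hi : ∀ x y, f (x ⊓ y) = f x ⊓ f y)
    (hs : ∀ x y, f (x ⊔ y) = f x ⊔ f y) (a b : α) :
    generated f (con a b) = con (f a) (f b) := by
  refine le_antisymm (fun x y h => h _ fun x y hxy => ?_)
    (con_le fun φ hφ => hφ a b (r_con a b))
  exact hxy (comap f hi hs (con (f a) (f b))) (r_con (f a) (f b))

/-- From `b ≡ t`, meet with `a` and join with `m`; from `m ≡ t`, meet with `c` and join with `b`. -/
theorem con_eq_con_of_inf_le {a b c m o t : α} (ho : o ≤ m) (hab : a ⊓ b ≤ o)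
    (hmt : m ≤ t) (hat : a ≤ t) (hct : c ≤ t) (hma : t ≤ m ⊔ a) (hmc : m ⊓ c ≤ b)
    (hcb : t ≤ c ⊔ b) (hbt : b ≤ t) : con m t = con b t := by
  refine le_antisymm (con_le ?_) (con_le ?_)
  · have h := (con b t).sup ((con b t).inf (r_con b t) ((con b t).iseqv.refl a))
      ((con b t).iseqv.refl m)
    rwa [sup_eq_right.2 (inf_comm b a ▸ hab.trans ho), inf_eq_right.2 hat,
      sup_comm, le_antisymm (sup_le hmt hat) hma] at h
  · have h := (con m t).sup ((con m t).inf (r_con m t) ((con m t).iseqv.refl c))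
      ((con m t).iseqv.refl b)
    rwa [sup_eq_right.2 hmc, inf_eq_right.2 hct, le_antisymm (sup_le hct hbt) hcb] at h

/-- Equality as a congruence. -/
def equality (α : Type*) [Lattice α] : LatticeCon α where
  r := Eq
  iseqv := eq_equivalence
  inf h h' := by rw [h, h']
  sup h h' := by rw [h, h']

/-- The transitive closure of the union of two congruences. -/
def transUnion (β γ : LatticeCon α) : LatticeCon α where
  r := Relation.ReflTransGen fun x y => β.r x y ∨ γ.r x y
  iseqv :=
    { refl := fun _ => Relation.ReflTransGen.refl
      symm := fun h => Relation.ReflTransGen.mono (fun _ _ => Or.imp β.iseqv.symm γ.iseqv.symm) _ _ h.swap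
      trans := fun h h' => h.trans h' }
  inf {_ x y _} h h' :=
    (h.lift (· ⊓ y) fun _ _ => Or.imp (β.inf · (β.iseqv.refl y)) (γ.inf · (γ.iseqv.refl y))).trans
      (h'.lift (x ⊓ ·) fun _ _ => Or.imp (β.inf (β.iseqv.refl x)) (γ.inf (γ.iseqv.refl x)))
  sup {_ x y _} h h' :=
    (h.lift (· ⊔ y) fun _ _ => Or.imp (β.sup · (β.iseqv.refl y)) (γ.sup · (γ.iseqv.refl y))).trans
      (h'.lift (x ⊔ ·) fun _ _ => Or.imp (β.sup (β.iseqv.refl x)) (γ.sup (γ.iseqv.refl x)))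

theorem sup_le_transUnion (β γ : LatticeCon α) : β ⊔ γ ≤ transUnion β γ :=
  sup_le (fun _ _ h => Relation.ReflTransGen.single (Or.inl h))
    fun _ _ h => Relation.ReflTransGen.single (Or.inr h)

/-- Project a chain from `a` to `b` into the prime interval by `z ↦ (z ⊔ a) ⊓ b`. Only the values
`a` and `b` occur, so some single step jumps from `a` to `b`, and the congruence behind that step
collapses them. -/
theorem r_or_r_of_transUnion {β γ : LatticeCon α} {a b : α} (hab : a ⋖ b)
    (h : (transUnion β γ).r a b) : β.r a b ∨ γ.r a b := by
  by_contra! hn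
  have key : ∀ z, (transUnion β γ).r a z → (z ⊔ a) ⊓ b = a := by
    intro z hz
    induction hz with
    | refl => rw [sup_idem, inf_eq_left.2 hab.le]
    | @tail y z _ hyz ih =>
      refine (hab.eq_or_eq (le_inf le_sup_right hab.le) inf_le_right).resolve_right fun hb => ?_
      have aux : ∀ θ : LatticeCon α, θ.r y z → θ.r a b := fun θ h => by
        have := θ.inf (θ.sup h (θ.iseqv.refl a)) (θ.iseqv.refl b)
        rwa [ih, hb] at this
      exact hyz.elim (fun h => hn.1 (aux β h)) fun h => hn.2 (aux γ h)
  have := key b h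
  rw [sup_eq_left.2 hab.le, inf_idem] at this
  exact hab.lt.ne' this

/-- In any lattice, the congruence generated by a prime interval is join-irreducible. -/
theorem supIrred_con {a b : α} (hab : a ⋖ b) : SupIrred (con a b) := by
  refine ⟨fun h => ?_, fun β γ h => ?_⟩
  · have h₁ : equality α ≤ con a b := fun x y hxy => by
      subst hxy
      exact (con a b).iseqv.refl x
    exact hab.lt.ne (h h₁ (r_con a b))
  · rcases r_or_r_of_transUnion hab
      (sup_le_transUnion β γ (h.symm ▸ r_con a b : (β ⊔ γ).r a b)) with h' | h'
    · exact Or.inl (le_antisymm (h ▸ le_sup_left) (con_le h'))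
    · exact Or.inr (le_antisymm (h ▸ le_sup_right) (con_le h'))

end Generation

end LatticeCon

/-! ### Comparison of `γ(S)` with congruences generated from `L` -/

namespace ForkExt

section Gamma

variable {L : Type*} [Lattice L] {S : CoveringSquare L} (h : IsLatticeOrder (ForkExt S))

theorem old_inf (a b : L) :
    letI := h.toLattice
    (old (a ⊓ b) : ForkExt S) = old a ⊓ old b :=
  let := h.toLattice
  (isGLB_old a b).unique isGLB_pair

theorem old_sup (a b : L) :
    letI := h.toLattice
    (old (a ⊔ b) : ForkExt S) = old a ⊔ old b :=
  let := h.toLattice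
  (isLUB_old a b).unique isLUB_pair

theorem generatedBy_con (a b : L) :
    generatedBy h (LatticeCon.con a b) =
      @LatticeCon.con (ForkExt S) h.toLattice (old a) (old b) :=
  let := h.toLattice
  LatticeCon.generated_con (old : L → ForkExt S)
    (old_inf h) (old_sup h) a b

theorem gamma_eq_right {c : L} (hc : c ⋖ S.t) (hne : c ≠ S.ar) (hle : S.al ⊓ c ≤ S.ar) :
    gamma h = generatedBy h (LatticeCon.con S.ar S.t) := by
  rw [generatedBy_con]
  let := h.toLattice
  have hS := S.isCoveringSquare
  have hm := isLUB_m_left (S := S)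
  exact LatticeCon.con_eq_con_of_inf_le (a := (old S.al : ForkExt S)) (c := old c)
    (o := old S.o) old_bot_le_m
    (old_inf h S.al S.ar ▸ old_le_old.2 hS.inf_eq.le)
    (hm.1 (by simp)) (hm.1 (by simp)) (old_le_old.2 hc.le) (hm.unique isLUB_pair).le
    (le_old_right hc.lt.not_ge hle inf_le_left inf_le_right)
    (old_sup h c S.ar ▸
      old_le_old.2 (hc.sup_eq_of_ne hS.right_covBy_top hne).ge)
    (old_le_old.2 hS.right_covBy_top.le)

theorem gamma_eq_left {c : L} (hc : c ⋖ S.t) (hne : c ≠ S.al) (hle : c ⊓ S.ar ≤ S.al) :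
    gamma h = generatedBy h (LatticeCon.con S.al S.t) := by
  rw [generatedBy_con]
  let := h.toLattice
  have hS := S.isCoveringSquare
  have hm := isLUB_m_right (S := S)
  exact LatticeCon.con_eq_con_of_inf_le (a := (old S.ar : ForkExt S)) (c := old c)
    (o := old S.o) old_bot_le_m
    (old_inf h S.ar S.al ▸ old_le_old.2 (inf_comm S.ar S.al ▸ hS.inf_eq.le))
    (hm.1 (by simp)) (hm.1 (by simp)) (old_le_old.2 hc.le) (hm.unique isLUB_pair).le
    (le_old_left hc.lt.not_ge hle inf_le_left inf_le_right)
    (old_sup h c S.al ▸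
      old_le_old.2 (hc.sup_eq_of_ne hS.left_covBy_top hne).ge)
    (old_le_old.2 hS.left_covBy_top.le)

end Gamma

end ForkExt

/-- In a slim lattice, no lower cover of the top of a covering square lies above its bottom. -/
theorem IsSlim.not_bot_le {L : Type*} [Lattice L] (hL : IsSlim L) (S : CoveringSquare L) {a : L}
    (ha : a ⋖ S.t) (hal : a ≠ S.al) (har : a ≠ S.ar) : ¬ S.o ≤ a := by
  intro ho
  have hS := S.isCoveringSquare
  have aux : ∀ {x : L}, S.o ⋖ x → x ⋖ S.t → a ≠ x → x ⊓ a = S.o := fun hx hxt hne =>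
    (hx.eq_or_eq (le_inf hx.le ho) inf_le_left).resolve_right fun h =>
      (hxt.eq_or_eq (inf_eq_left.1 h) ha.le).elim hne ha.lt.ne
  have hne : S.al ≠ S.ar := fun h => hS.bot_covBy_left.lt.ne' (by
    rw [← hS.inf_eq, ← h, inf_idem])
  have i₁ := aux hS.bot_covBy_left hS.left_covBy_top hal
  have i₂ := aux hS.bot_covBy_right hS.right_covBy_top har
  exact hL ⟨S.al, S.ar, a, hne, hal.symm, har.symm, hS.inf_eq.trans i₁.symm,
    hS.inf_eq.trans i₂.symm,
    hS.sup_eq.trans (hS.left_covBy_top.sup_eq_of_ne ha hal.symm).symm,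
    hS.sup_eq.trans (hS.right_covBy_top.sup_eq_of_ne ha har.symm).symm⟩

theorem theorem2 {L : Type*} [Lattice L] [Finite L] [IsUpperModularLattice L]
    (hslim : IsSlim L) (D : PlanarDiagram L) (S : CoveringSquare L)
    (hleft : D.LeftOf S.t S.al S.ar) (hwide : S.IsWide) :
    ∃ h : IsLatticeOrder (ForkExt S),
      SupIrred (LatticeCon.con S.al S.t) ∧
      SupIrred (LatticeCon.con S.ar S.t) ∧
      (∀ a : L, D.LeftOf S.t S.ar a →
        ForkExt.gamma h = ForkExt.generatedBy h (LatticeCon.con S.ar S.t)) ∧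
      (∀ a : L, D.LeftOf S.t a S.al →
        ForkExt.gamma h = ForkExt.generatedBy h (LatticeCon.con S.al S.t)) ∧
      (ForkExt.gamma h = ForkExt.generatedBy h (LatticeCon.con S.ar S.t) ∨
        ForkExt.gamma h = ForkExt.generatedBy h (LatticeCon.con S.al S.t)) := by
  have hal := S.isCoveringSquare.left_covBy_top
  have har := S.isCoveringSquare.right_covBy_top
  have h := ForkExt.isLatticeOrder (S := S) (hslim.eq_or_eq_of_covBy D)
  have hr : ∀ a : L, D.LeftOf S.t S.ar a →
      ForkExt.gamma h = ForkExt.generatedBy h (LatticeCon.con S.ar S.t) := fun a ha =>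
    ForkExt.gamma_eq_right h ha.2.1 (by rintro rfl; exact lt_irrefl _ ha.2.2)
      (D.inf_le_of_leftOf hleft ha)
  have hl : ∀ a : L, D.LeftOf S.t a S.al →
      ForkExt.gamma h = ForkExt.generatedBy h (LatticeCon.con S.al S.t) := fun a ha =>
    ForkExt.gamma_eq_left h ha.1 (by rintro rfl; exact lt_irrefl _ ha.2.2)
      (D.inf_le_of_leftOf ha hleft)
  refine ⟨h, LatticeCon.supIrred_con hal, LatticeCon.supIrred_con har, hr, hl, ?_⟩
  obtain ⟨a, ha, hne, hne'⟩ := hwide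
  rcases D.leftOf_or ha har hne' with h₁ | h₁
  · rcases D.leftOf_or ha hal hne with h₂ | h₂
    · exact Or.inr (hl a h₂)
    -- Here `a` lies between `aₗ` and `aᵣ`, so planarity gives `o = aₗ ⊓ aᵣ ≤ a`, which slimness
    -- excludes.
    · exact absurd (S.isCoveringSquare.inf_eq ▸ D.inf_le_of_leftOf h₂ h₁)
        (hslim.not_bot_le S ha hne hne')
  · exact Or.inl (hr a h₁)
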